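/- Let $n\ge 0$ be an integer, let $\mathbb{Z}_2^n$ be the vector space of dimension $n$ over the two-element field, let $\oplus$ denote its addition and $\langle x,y\rangle = x_1y_1\oplus\dots\oplus x_ny_n$. The Maiorana--McFarland class $\mathcal{M}_{2n}$ is the set of all Boolean functions $f_{\pi,\varphi}:\mathbb{Z}_2^{n}\times\mathbb{Z}_2^{n}\to\mathbb{Z}_2$ of the form $f_{\pi,\varphi}(x,y)=\langle x,\pi(y)\rangle\oplus\varphi(y)$, where $\pi$ is a permutation of $\mathbb{Z}_2^n$ and $\varphi:\mathbb{Z}_2^n\to\mathbb{Z}_2$ is arbitrary. For $f\in\mathcal{M}_{2n}$ let $$\mathcal{N}(f)=\{\, f\oplus \mathbf{1}_U : U \text{ is an } n\text{-dimensional affine subspace of } \mathbb{Z}_2^{2n}=\mathbb{Z}_2^{n}\times\mathbb{Z}_2^{n} \text{ such that } f|_U \text{ is affine}\,\},$$ where $\mathbf{1}_U$ is the characteristic function of $U$ and $f|_U$ is called affine if it coincides on $U$ with an affine function $\mathbb{Z}_2^{2n}\to\mathbb{Z}_2$. Then $$\frac{1}{|\mathcal{M}_{2n}|}\sum_{f\in\mathcal{M}_{2n}}|\mathcal{N}(f)|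 \;=\; 2^{2n+1}-2^n+\sum_{k=2}^{n}\rho(n,k)\cdot 2^{(k+1)^2-2^k},$$ where, for $0\le k\le n$, $$\rho(n,k)=2^{2(n-k)}\begin{bmatrix} n\\ k\end{bmatrix}_2^{2}\,\frac{(2^k)!\,(2^n-2^k)!}{(2^n)!},\qquad \begin{bmatrix} n\\ k\end{bmatrix}_2=\prod_{i=0}^{k-1}\frac{2^n-2^i}{2^k-2^i}.$$ -/

import Mathlib

/-- The vector space `ℤ₂ⁿ` over the two-element field. -/
abbrev BVec (n : ℕ) : Type := Fin n → ZMod 2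

/-- Boolean functions in `2n` variables, the variables being split into two halves `(x, y)`. -/
abbrev BoolFun (n : ℕ) : Type := BVec n × BVec n → ZMod 2

/-- The function `f_{π,φ}(x, y) = ⟨x, π(y)⟩ ⊕ φ(y)`. -/
def mmFun {n : ℕ} (π : Equiv.Perm (BVec n)) (φ : BVec n → ZMod 2) : BoolFun n :=
  fun p => p.1 ⬝ᵥ π p.2 + φ p.2

/-- The Maiorana--McFarland class `M_{2n}`, as a set of Boolean functions in `2n` variables. -/
def MMClass (n : ℕ) : Set (BoolFun n) :=
  {f | ∃ (π : Equiv.Perm (BVec n)) (φ : BVec n → ZMod 2), f = mmFun π φ}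

/-- The characteristic Boolean function of a set. -/
noncomputable def charFun {n : ℕ} (S : Set (BVec n × BVec n)) : BoolFun n :=
  S.indicator 1

/-- `U` is a (nonempty) `k`-dimensional affine subspace of `ℤ₂²ⁿ`. -/
def IsAffineSubspaceOfDim {n : ℕ} (k : ℕ)
    (U : AffineSubspace (ZMod 2) (BVec n × BVec n)) : Prop :=
  (U : Set (BVec n × BVec n)).Nonempty ∧ Module.finrank (ZMod 2) U.direction = k

/-- `f` is affine on `U`: its restriction to `U` is the restriction of an affine function. -/
def IsAffineOn {n : ℕ} (f : BoolFun n)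
    (U : AffineSubspace (ZMod 2) (BVec n × BVec n)) : Prop :=
  ∃ g : (BVec n × BVec n) →ᵃ[ZMod 2] ZMod 2, Set.EqOn f g U

/-- `N(f)`: all functions `f ⊕ 1_U`, where `U` is an `n`-dimensional affine subspace of `ℤ₂²ⁿ`
on which `f` is affine. -/
def near {n : ℕ} (f : BoolFun n) : Set (BoolFun n) :=
  {g | ∃ U : AffineSubspace (ZMod 2) (BVec n × BVec n),
    IsAffineSubspaceOfDim n U ∧ IsAffineOn f U ∧ g = f + charFun (U : Set (BVec n × BVec n))}

/-- The average of `|N(f)|` over the functions `f` of the Maiorana--McFarland class. -/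
noncomputable def nearAverage (n : ℕ) : ℚ :=
  (∑ f ∈ (MMClass n).toFinite.toFinset, ((near f).ncard : ℚ)) / ((MMClass n).ncard : ℚ)

/-- The Gaussian binomial coefficient with base `2`; the product vanishes for `k > n`. -/
def gaussBinom (n k : ℕ) : ℚ :=
  ∏ i ∈ Finset.range k, ((2 : ℚ) ^ n - 2 ^ i) / ((2 : ℚ) ^ k - 2 ^ i)

/-- `ρ(n, k)`, used for `k ≤ n`. -/
def rho (n k : ℕ) : ℚ :=
  (2 : ℚ) ^ (2 * (n - k)) * gaussBinom n k ^ 2 *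
    ((2 ^ k).factorial : ℚ) * ((2 ^ n - 2 ^ k).factorial : ℚ) / ((2 ^ n).factorial : ℚ)

/-! The proof is a double count. Both `(π, φ) ↦ f_{π,φ}` and `U ↦ f + 1_U` are injective, so the sum
counts triples `(π, φ, U)` with `f_{π,φ}` affine on `U`. Let `D` be the direction of `U`, `W` its
projection to the `y`-half, `E` its fibre over `0`, and `k = dim W`, so `dim E = n - k`. By the
Goursat-type description, `D` amounts to `W`, `E` and a linear map from `W` to the quotient by `E`;
with `2^n` cosets this gives `[n,k]² 2^{k²} 2^n` subspaces `U` (`natCard_affineSubspace_sndProj`).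
For a fixed `U` over `y₀ + W`, some `φ` works iff `π` sends `y₀ + W` into a coset of `E^⊥`, which
also has dimension `k`; the good `φ` are then a translate of the functions affine on `y₀ + W`
(`natCard_isAffineOn_mmFun`). Dividing by `(2^n)! 2^{2^n}` gives the summand for each `k` from `0`
to `n`; the terms `k = 0, 1` add up to the part outside the sum. -/

theorem natCard_eq_sum_natCard_fiber {α β : Type*} [Finite α] [Fintype β] (f : α → β) :
    Nat.card α = ∑ b, Nat.card {a // f a = b} := by
  rw [← Nat.card_sigma]
  exact Nat.card_congr (Equiv.sigmaFiberEquiv f).symm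

theorem natCard_eq_mul_of_natCard_fiber {α β : Type*} [Finite α] [Finite β] (f : α → β) (c : ℕ)
    (h : ∀ b, Nat.card {a // f a = b} = c) : Nat.card α = Nat.card β * c := by
  have := Fintype.ofFinite β
  simp [natCard_eq_sum_natCard_fiber f, h]

/-! ### Counting subspaces by their bases; Gaussian binomials. -/

section Subspaces

variable {K V : Type*} [Field K] [Finite K] [AddCommGroup V] [Module K V] [Finite V]

theorem natCard_linearIndependent {k : ℕ} (hk : k ≤ Module.finrank K V) :
    Nat.card {s : Fin k → V // LinearIndependent K s} =
      ∏ i : Fin k, (Nat.card K ^ Module.finrank K V - Nat.card K ^ (i : ℕ)) := by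
  have := Fintype.ofFinite K
  simp only [Nat.card_eq_fintype_card (α := K)]
  exact card_linearIndependent hk

/-- Linearly independent families spanning `W` are linearly independent families in `W`, when the
length of the family is the dimension of `W`. -/
noncomputable def linearIndependentSpanEquiv {k : ℕ} (W : Submodule K V)
    (hW : Module.finrank K W = k) :
    {s : {s : Fin k → V // LinearIndependent K s} // Submodule.span K (Set.range s.1) = W} ≃
      {s : Fin k → W // LinearIndependent K s} where
  toFun s := ⟨fun i => ⟨s.1.1 i, by
      have h := s.2
      have : s.1.1 i ∈ Submodule.span K (Set.range s.1.1) := Submodule.subset_span ⟨i, rfl⟩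
      rwa [h] at this⟩,
    LinearIndependent.of_comp W.subtype s.1.2⟩
  invFun s := ⟨⟨fun i => s.1 i, s.2.map' W.subtype W.ker_subtype⟩, by
    have h : LinearIndependent K (fun i => (s.1 i : V)) := s.2.map' W.subtype W.ker_subtype
    apply Submodule.eq_of_le_of_finrank_eq
    · rw [Submodule.span_le]
      rintro _ ⟨i, rfl⟩
      exact (s.1 i).2
    · rw [finrank_span_eq_card h, Fintype.card_fin, hW]⟩
  left_inv s := rfl
  right_inv s := rfl

/-- Group independent `k`-tuples by their span: each fibre is the set of ordered bases of one
subspace. -/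
theorem natCard_submodule_mul {k : ℕ} (hk : k ≤ Module.finrank K V) :
    Nat.card {W : Submodule K V // Module.finrank K W = k} *
        ∏ i : Fin k, (Nat.card K ^ k - Nat.card K ^ (i : ℕ)) =
      ∏ i : Fin k, (Nat.card K ^ Module.finrank K V - Nat.card K ^ (i : ℕ)) := by
  rw [← natCard_linearIndependent hk]
  symm
  refine natCard_eq_mul_of_natCard_fiber
    (fun s : {s : Fin k → V // LinearIndependent K s} =>
      (⟨Submodule.span K (Set.range s.1), by
        rw [finrank_span_eq_card s.2, Fintype.card_fin]⟩ :
        {W : Submodule K V // Module.finrank K W = k})) _ ?_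
  rintro ⟨W, hW⟩
  simp only [Subtype.mk.injEq]
  rw [Nat.card_congr (linearIndependentSpanEquiv W hW), natCard_linearIndependent hW.ge, hW]

end Subspaces

theorem gaussBinom_eq {V : Type*} [AddCommGroup V] [Module (ZMod 2) V] [Finite V] {n k : ℕ}
    (hn : Module.finrank (ZMod 2) V = n) (hk : k ≤ n) :
    (Nat.card {W : Submodule (ZMod 2) V // Module.finrank (ZMod 2) W = k} : ℚ) =
      gaussBinom n k := by
  have h := natCard_submodule_mul (K := ZMod 2) (V := V) (hn.symm ▸ hk)
  rw [hn, Nat.card_zmod] at h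
  have hcast : ∀ m, k ≤ m → ((∏ i : Fin k, (2 ^ m - 2 ^ (i : ℕ)) : ℕ) : ℚ) =
      ∏ i ∈ Finset.range k, ((2 : ℚ) ^ m - 2 ^ i) := by
    intro m hm
    rw [Finset.prod_range, Nat.cast_prod]
    refine Finset.prod_congr rfl fun i _ => ?_
    rw [Nat.cast_sub (Nat.pow_le_pow_right two_pos (by omega))]
    push_cast
    rfl
  have h' := congrArg (Nat.cast : ℕ → ℚ) h
  rw [Nat.cast_mul, hcast k le_rfl, hcast n hk] at h'
  rw [gaussBinom, Finset.prod_div_distrib, eq_div_iff, h']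
  refine Finset.prod_ne_zero_iff.2 fun i hi => ?_
  have : (2 : ℚ) ^ i < 2 ^ k := pow_lt_pow_right₀ one_lt_two (Finset.mem_range.1 hi)
  exact (sub_pos.2 this).ne'

/-! ### Permutations carrying one subset to another. -/

open Classical in
/-- A permutation carrying `p` to `q` is a bijection between `p` and `q` together with a bijection
between their complements. -/
noncomputable def permSubtypeEquiv {α : Type*} (p q : α → Prop) :
    {π : Equiv.Perm α // ∀ a, p a ↔ q (π a)} ≃
      ({a // p a} ≃ {a // q a}) × ({a // ¬ p a} ≃ {a // ¬ q a}) where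
  toFun π := (π.1.subtypeEquiv π.2, π.1.subtypeEquiv fun a => not_congr (π.2 a))
  invFun e := ⟨Equiv.subtypeCongr e.1 e.2, fun a => by
    by_cases h : p a
    · simpa [Equiv.subtypeCongr, h] using (e.1 ⟨a, h⟩).2
    · simpa [Equiv.subtypeCongr, h] using (e.2 ⟨a, h⟩).2⟩
  left_inv π := by
    ext a
    by_cases h : p a <;> simp [Equiv.subtypeCongr, h]
  right_inv e := by
    ext a
    · simp [Equiv.subtypeCongr, a.2]
    · simp [Equiv.subtypeCongr, a.2]

theorem natCard_equiv_of_eq {α β : Type*} [Finite α] [Finite β]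
    (h : Nat.card α = Nat.card β) : Nat.card (α ≃ β) = (Nat.card α).factorial := by
  have e : α ≃ β := (Finite.equivFinOfCardEq h).trans (Finite.equivFin β).symm
  rw [← Nat.card_perm]
  exact Nat.card_congr (Equiv.equivCongr (Equiv.refl α) e.symm)

theorem natCard_not_subtype {α : Type*} [Finite α] (p : α → Prop) :
    Nat.card {a // ¬ p a} = Nat.card α - Nat.card {a // p a} := by
  classical
  have := Fintype.ofFinite α
  simp only [Nat.card_eq_fintype_card]
  exact Fintype.card_subtype_compl p

/-- Equal cardinalities turn inclusion of the image into equality, so the permutation splits into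
bijections of the subsets and of their complements. -/
theorem natCard_perm_maps {α : Type*} [Finite α] (p q : α → Prop)
    (h : Nat.card {a // p a} = Nat.card {a // q a}) :
    Nat.card {π : Equiv.Perm α // ∀ a, p a → q (π a)} =
      (Nat.card {a // p a}).factorial * (Nat.card α - Nat.card {a // p a}).factorial := by
  have key : ∀ π : Equiv.Perm α, (∀ a, p a → q (π a)) ↔ ∀ a, p a ↔ q (π a) := by
    refine fun π => ⟨fun hπ => ?_, fun hπ a => (hπ a).1⟩
    have hb := Function.Injective.bijective_of_nat_card_le
      (f := fun a : {a // p a} => (⟨π a, hπ a a.2⟩ : {a // q a}))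
      (fun a b hab => Subtype.ext (π.injective (congrArg Subtype.val hab))) h.ge
    refine fun a => ⟨hπ a, fun ha => ?_⟩
    obtain ⟨b, hb⟩ := hb.2 ⟨π a, ha⟩
    exact π.injective (congrArg Subtype.val hb) ▸ b.2
  rw [Nat.card_congr ((Equiv.subtypeEquivRight key).trans (permSubtypeEquiv p q)), Nat.card_prod,
    natCard_equiv_of_eq h, natCard_equiv_of_eq, natCard_not_subtype]
  rw [natCard_not_subtype, natCard_not_subtype, h]

/-! ### Permutations and affine functions on cosets. -/

section Cosets

variable {K V : Type*} [Field K] [AddCommGroup V] [Module K V]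

theorem natCard_affineSubspace_of_direction_eq (D : Submodule K V) :
    Nat.card {U : AffineSubspace K V // (U : Set V).Nonempty ∧ U.direction = D} =
      Nat.card (V ⧸ D) := by
  symm
  refine Nat.card_eq_of_bijective (fun c => ⟨AffineSubspace.mk' (Quotient.out c) D,
    ⟨_, AffineSubspace.self_mem_mk' _ _⟩, AffineSubspace.direction_mk' _ _⟩) ⟨?_, ?_⟩
  · intro c d h
    have h' : AffineSubspace.mk' (Quotient.out c) D = AffineSubspace.mk' (Quotient.out d) D :=
      congrArg Subtype.val h
    have h1 : Quotient.out c ∈ AffineSubspace.mk' (Quotient.out d) D :=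
      h' ▸ AffineSubspace.self_mem_mk' _ _
    rw [AffineSubspace.mem_mk', vsub_eq_sub] at h1
    rw [← Quotient.out_eq c, ← Quotient.out_eq d]
    exact (Submodule.Quotient.eq D).2 h1
  · rintro ⟨U, ⟨p, hp⟩, rfl⟩
    refine ⟨Submodule.Quotient.mk p, Subtype.ext ?_⟩
    have hmem : Quotient.out (Submodule.Quotient.mk p : V ⧸ U.direction) ∈ U := by
      have h1 : (Quotient.out (Submodule.Quotient.mk p : V ⧸ U.direction)) - p ∈ U.direction :=
        (Submodule.Quotient.eq _).1 (Quotient.out_eq _)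
      simpa using AffineSubspace.vadd_mem_of_mem_direction h1 hp
    exact AffineSubspace.mk'_eq hmem

theorem natCard_sub_mem (F : Submodule K V) (v : V) :
    Nat.card {u // u - v ∈ F} = Nat.card F :=
  Nat.card_congr ((Equiv.subRight v).subtypeEquiv fun _ => Iff.rfl)

/-- The number of permutations carrying a coset of `W` into some coset of `F`. -/
theorem natCard_perm_coset [Finite V] (W F : Submodule K V) (y₀ : V)
    (h : Nat.card W = Nat.card F) :
    Nat.card {π : Equiv.Perm V // ∀ y, y - y₀ ∈ W → π y - π y₀ ∈ F} =
      Nat.card (V ⧸ F) * ((Nat.card W).factorial * (Nat.card V - Nat.card W).factorial) := by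
  have : Finite (V ⧸ F) := Finite.of_surjective _ F.mkQ_surjective
  refine natCard_eq_mul_of_natCard_fiber (fun π => Submodule.Quotient.mk (π.1 y₀)) _ fun c => ?_
  obtain ⟨v, rfl⟩ := Submodule.Quotient.mk_surjective F c
  rw [← natCard_sub_mem W y₀, ← natCard_perm_maps (fun y => y - y₀ ∈ W) (fun u => u - v ∈ F)
    (by rw [natCard_sub_mem, natCard_sub_mem, h])]
  refine Nat.card_congr ((Equiv.subtypeSubtypeEquivSubtypeInter _ fun π : Equiv.Perm V =>
    (Submodule.Quotient.mk (π y₀) : V ⧸ F) = Submodule.Quotient.mk v).trans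
    (Equiv.subtypeEquivRight fun π => ?_))
  rw [Submodule.Quotient.eq]
  constructor
  · rintro ⟨h1, h2⟩ y hy
    simpa using F.add_mem (h1 y hy) h2
  · intro h1
    have h2 := h1 y₀ (by simp)
    exact ⟨fun y hy => by simpa using F.sub_mem (h1 y hy) h2, h2⟩

open Classical in
/-- The number of functions whose restriction to the coset `y₀ + W` is affine. -/
theorem natCard_affine_on_coset [Finite K] [Finite V] (W : Submodule K V) (y₀ : V) :
    Nat.card {φ : V → K // ∃ (l : W →ₗ[K] K) (c : K), ∀ w : W, φ (y₀ + w) = l w + c} =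
      Nat.card W * Nat.card K * Nat.card K ^ (Nat.card V - Nat.card W) := by
  have hd : Nat.card (W →ₗ[K] K) = Nat.card W := by
    rw [Module.natCard_eq_pow_finrank (K := K) (V := W →ₗ[K] K),
      Module.natCard_eq_pow_finrank (K := K) (V := W), Module.finrank_linearMap_self]
  have hc : Nat.card ({y // ¬ (y - y₀ ∈ W)} → K) = Nat.card K ^ (Nat.card V - Nat.card W) := by
    rw [Nat.card_fun, natCard_not_subtype, natCard_sub_mem]
  rw [← hc, ← hd, ← Nat.card_prod, ← Nat.card_prod]
  symm
  -- The data are a linear form and a constant on the coset, and arbitrary values off it.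
  refine Nat.card_eq_of_bijective (fun t => ⟨fun y => if h : y - y₀ ∈ W then
    t.1.1 ⟨y - y₀, h⟩ + t.1.2 else t.2 ⟨y, h⟩, t.1.1, t.1.2, fun w => by simp⟩) ⟨?_, ?_⟩
  · rintro ⟨⟨l, c⟩, ψ⟩ ⟨⟨l', c'⟩, ψ'⟩ h
    have h' := congrFun (congrArg Subtype.val h)
    have hW : ∀ w : W, l w + c = l' w + c' := fun w => by simpa using h' (y₀ + w)
    have hcc : c = c' := by simpa using hW 0
    subst hcc
    have hl : l = l' := LinearMap.ext fun w => add_right_cancel (hW w)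
    have hψ : ψ = ψ' := by
      ext ⟨y, hy⟩
      simpa [hy] using h' y
    rw [hl, hψ]
  · rintro ⟨φ, l, c, hφ⟩
    refine ⟨⟨⟨l, c⟩, fun y => φ y⟩, Subtype.ext (funext fun y => ?_)⟩
    by_cases h : y - y₀ ∈ W
    · simpa [h] using (hφ ⟨y - y₀, h⟩).symm
    · simp [h]

end Cosets

/-! ### Goursat description of subspaces of a product. -/

section Goursat

variable {K V₁ V₂ : Type*} [Field K] [AddCommGroup V₁] [Module K V₁] [AddCommGroup V₂]
  [Module K V₂]

/-- The submodule of `V₁ × V₂` with projection `W` and fibres the cosets of `E` given by `h`. -/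
def fiberedSubmodule (W : Submodule K V₂) (E : Submodule K V₁) (h : W →ₗ[K] V₁ ⧸ E) :
    Submodule K (V₁ × V₂) where
  carrier := {p | ∃ hp : p.2 ∈ W, E.mkQ p.1 = h ⟨p.2, hp⟩}
  zero_mem' := ⟨W.zero_mem, by
    rw [Prod.fst_zero, map_zero]
    exact (map_zero h).symm⟩
  add_mem' := by
    rintro p r ⟨hp, hp'⟩ ⟨hr, hr'⟩
    refine ⟨W.add_mem hp hr, ?_⟩
    rw [Prod.fst_add, map_add, hp', hr', ← map_add]
    rfl
  smul_mem' := by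
    rintro c p ⟨hp, hp'⟩
    refine ⟨W.smul_mem c hp, ?_⟩
    rw [Prod.smul_fst, map_smul, hp', ← map_smul]
    rfl

theorem mem_fiberedSubmodule {W : Submodule K V₂} {E : Submodule K V₁} {h : W →ₗ[K] V₁ ⧸ E}
    {p : V₁ × V₂} : p ∈ fiberedSubmodule W E h ↔ ∃ hp : p.2 ∈ W, E.mkQ p.1 = h ⟨p.2, hp⟩ :=
  Iff.rfl

theorem map_snd_fiberedSubmodule (W : Submodule K V₂) (E : Submodule K V₁)
    (h : W →ₗ[K] V₁ ⧸ E) : (fiberedSubmodule W E h).map (LinearMap.snd K V₁ V₂) = W := by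
  ext y
  simp only [Submodule.mem_map, mem_fiberedSubmodule, LinearMap.snd_apply]
  constructor
  · rintro ⟨p, ⟨hp, -⟩, rfl⟩
    exact hp
  · intro hy
    obtain ⟨x, hx⟩ := E.mkQ_surjective (h ⟨y, hy⟩)
    exact ⟨(x, y), ⟨hy, hx⟩, rfl⟩

theorem comap_inl_fiberedSubmodule (W : Submodule K V₂) (E : Submodule K V₁)
    (h : W →ₗ[K] V₁ ⧸ E) : (fiberedSubmodule W E h).comap (LinearMap.inl K V₁ V₂) = E := by
  ext x
  simp only [Submodule.mem_comap, mem_fiberedSubmodule, LinearMap.inl_apply]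
  have h0 : h ⟨0, W.zero_mem⟩ = 0 := map_zero h
  simp [h0]

/-- Two points of `D` over the same `y` differ by an element of the fibre over `0`, so the first
coordinate modulo that fibre is a linear function of `y`. -/
theorem exists_fiberedSubmodule_eq (D : Submodule K (V₁ × V₂)) :
    ∃ h, fiberedSubmodule (D.map (LinearMap.snd K V₁ V₂)) (D.comap (LinearMap.inl K V₁ V₂)) h =
      D := by
  have hex : ∀ y : D.map (LinearMap.snd K V₁ V₂), ∃ x, (x, (y : V₂)) ∈ D := by
    rintro ⟨_, p, hp, rfl⟩
    exact ⟨p.1, hp⟩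
  choose a ha using hex
  have key : ∀ (y : D.map (LinearMap.snd K V₁ V₂)) (x : V₁), (x, (y : V₂)) ∈ D ↔
      (D.comap (LinearMap.inl K V₁ V₂)).mkQ x = (D.comap (LinearMap.inl K V₁ V₂)).mkQ (a y) := by
    intro y x
    rw [Submodule.mkQ_apply, Submodule.mkQ_apply, Submodule.Quotient.eq, Submodule.mem_comap,
      LinearMap.inl_apply]
    constructor
    · intro h
      simpa using D.sub_mem h (ha y)
    · intro h
      simpa using D.add_mem h (ha y)
  refine ⟨{ toFun := fun y => (D.comap (LinearMap.inl K V₁ V₂)).mkQ (a y)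
            map_add' := fun y z => ?_
            map_smul' := fun c y => ?_ }, ?_⟩
  · rw [← map_add]
    exact ((key (y + z) _).1 (D.add_mem (ha y) (ha z))).symm
  · rw [← map_smul]
    exact ((key (c • y) _).1 (D.smul_mem c (ha y))).symm
  · ext ⟨x, y⟩
    rw [mem_fiberedSubmodule]
    constructor
    · rintro ⟨hy, hx⟩
      exact (key ⟨y, hy⟩ x).2 hx
    · intro h
      exact ⟨⟨(x, y), h, rfl⟩, (key ⟨y, (x, y), h, rfl⟩ x).1 h⟩

theorem natCard_submodule_prod (W : Submodule K V₂) (E : Submodule K V₁) :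
    Nat.card {D : Submodule K (V₁ × V₂) // D.map (LinearMap.snd K V₁ V₂) = W ∧
      D.comap (LinearMap.inl K V₁ V₂) = E} = Nat.card (W →ₗ[K] V₁ ⧸ E) := by
  symm
  refine Nat.card_eq_of_bijective (fun h => ⟨fiberedSubmodule W E h,
    map_snd_fiberedSubmodule W E h, comap_inl_fiberedSubmodule W E h⟩) ⟨?_, ?_⟩
  · intro h h' heq
    have heq' : fiberedSubmodule W E h = fiberedSubmodule W E h' := congrArg Subtype.val heq
    ext ⟨y, hy⟩
    obtain ⟨x, hx⟩ := E.mkQ_surjective (h ⟨y, hy⟩)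
    have hmem : (x, y) ∈ fiberedSubmodule W E h := ⟨hy, hx⟩
    rw [heq'] at hmem
    obtain ⟨_, hx'⟩ := hmem
    rw [← hx, hx']
  · rintro ⟨D, rfl, rfl⟩
    obtain ⟨h, hh⟩ := exists_fiberedSubmodule_eq D
    exact ⟨h, Subtype.ext hh⟩

theorem finrank_map_snd_add_finrank_comap_inl [FiniteDimensional K V₁] [FiniteDimensional K V₂]
    (D : Submodule K (V₁ × V₂)) :
    Module.finrank K (D.map (LinearMap.snd K V₁ V₂)) +
      Module.finrank K (D.comap (LinearMap.inl K V₁ V₂)) = Module.finrank K D := by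
  rw [← LinearMap.finrank_range_add_finrank_ker ((LinearMap.snd K V₁ V₂).domRestrict D)]
  congr 1
  · rw [LinearMap.range_domRestrict]
  · let f : D.comap (LinearMap.inl K V₁ V₂) →ₗ[K]
        ((LinearMap.snd K V₁ V₂).domRestrict D).ker :=
      { toFun := fun x => ⟨⟨(x.1, 0), x.2⟩, by simp⟩
        map_add' := fun x y => by ext <;> simp
        map_smul' := fun c x => by ext <;> simp }
    refine LinearEquiv.finrank_eq (LinearEquiv.ofBijective f ⟨?_, ?_⟩)
    · intro x y h
      exact Subtype.ext (congrArg (fun z => z.1.1.1) h)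
    · rintro ⟨⟨⟨x, y⟩, hp⟩, h⟩
      obtain rfl : y = 0 := by simpa using h
      exact ⟨⟨x, hp⟩, rfl⟩

theorem natCard_submodule_prod_finrank [Finite K] [Finite V₁] [Finite V₂] {d k m : ℕ}
    (hm : m ≤ d) (hd : Module.finrank K V₁ = d) :
    Nat.card {D : Submodule K (V₁ × V₂) // Module.finrank K D = k + m ∧
        Module.finrank K (D.map (LinearMap.snd K V₁ V₂)) = k} =
      Nat.card {W : Submodule K V₂ // Module.finrank K W = k} *
        Nat.card {E : Submodule K V₁ // Module.finrank K E = m} *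
          Nat.card K ^ (k * (d - m)) := by
  rw [← Nat.card_prod]
  refine natCard_eq_mul_of_natCard_fiber (fun D => (⟨_, D.2.2⟩,
    ⟨D.1.comap (LinearMap.inl K V₁ V₂), by
      have := finrank_map_snd_add_finrank_comap_inl D.1
      have := D.2
      omega⟩)) _ ?_
  rintro ⟨⟨W, hW⟩, ⟨E, hE⟩⟩
  have hcard : Nat.card (W →ₗ[K] V₁ ⧸ E) = Nat.card K ^ (k * (d - m)) := by
    rw [Module.natCard_eq_pow_finrank (K := K), Module.finrank_linearMap, hW]
    have := Submodule.finrank_quotient_add_finrank E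
    congr 2
    omega
  rw [← hcard, ← natCard_submodule_prod W E]
  simp only [Prod.mk.injEq, Subtype.mk.injEq]
  refine Nat.card_congr ((Equiv.subtypeSubtypeEquivSubtypeInter _
    fun D : Submodule K (V₁ × V₂) => D.map (LinearMap.snd K V₁ V₂) = W ∧
      D.comap (LinearMap.inl K V₁ V₂) = E).trans (Equiv.subtypeEquivRight fun D => ?_))
  refine ⟨fun h => h.2, fun h => ⟨⟨?_, ?_⟩, h⟩⟩
  · rw [← finrank_map_snd_add_finrank_comap_inl, h.1, h.2, hW, hE]
  · rw [h.1, hW]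

end Goursat

/-! ### Orthogonal complements for the dot product. -/

section Orthogonal

variable {n : ℕ}

/-- The orthogonal complement for the standard dot product. -/
def dotOrthogonal (E : Submodule (ZMod 2) (BVec n)) : Submodule (ZMod 2) (BVec n) :=
  LinearMap.BilinForm.orthogonal (dotProductBilin (ZMod 2) (ZMod 2)) E

theorem mem_dotOrthogonal {E : Submodule (ZMod 2) (BVec n)} {v : BVec n} :
    v ∈ dotOrthogonal E ↔ ∀ e ∈ E, e ⬝ᵥ v = 0 := Iff.rfl

theorem dotProductBilin_isRefl :
    (dotProductBilin (ZMod 2) (ZMod 2) : LinearMap.BilinForm (ZMod 2) (BVec n)).IsRefl :=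
  fun v w h => (dotProduct_comm w v).trans h

theorem dotProductBilin_nondegenerate :
    (dotProductBilin (ZMod 2) (ZMod 2) : LinearMap.BilinForm (ZMod 2) (BVec n)).Nondegenerate :=
  ⟨fun v h => dotProduct_eq_zero v h,
    fun v h => dotProduct_eq_zero v fun w => (dotProduct_comm v w).trans (h w)⟩

theorem finrank_dotOrthogonal (E : Submodule (ZMod 2) (BVec n)) :
    Module.finrank (ZMod 2) (dotOrthogonal E) = n - Module.finrank (ZMod 2) E := by
  rw [dotOrthogonal, LinearMap.BilinForm.finrank_orthogonal dotProductBilin_nondegenerate,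
    Module.finrank_fin_fun]

theorem dotOrthogonal_dotOrthogonal (E : Submodule (ZMod 2) (BVec n)) :
    dotOrthogonal (dotOrthogonal E) = E :=
  LinearMap.BilinForm.orthogonal_orthogonal dotProductBilin_nondegenerate
    dotProductBilin_isRefl E

/-- Orthogonality is an involution exchanging the two dimensions. This makes the counts of `W` and
`E` equal, whence the square of the Gaussian binomial. -/
theorem natCard_submodule_compl_finrank {k : ℕ} (hk : k ≤ n) :
    Nat.card {E : Submodule (ZMod 2) (BVec n) // Module.finrank (ZMod 2) E = n - k} =
      Nat.card {E : Submodule (ZMod 2) (BVec n) // Module.finrank (ZMod 2) E = k} := by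
  refine Nat.card_congr ((Equiv.mk dotOrthogonal dotOrthogonal dotOrthogonal_dotOrthogonal
    dotOrthogonal_dotOrthogonal).subtypeEquiv fun E => ?_)
  have h1 := finrank_dotOrthogonal E
  have h2 := Submodule.finrank_le E
  rw [Module.finrank_fin_fun] at h2
  simp only [Equiv.coe_fn_mk]
  omega

end Orthogonal

/-! ### When a Maiorana–McFarland function is affine on a subspace. -/

section AffineOn

variable {n : ℕ}

theorem isAffineOn_iff {f : BoolFun n} {U : AffineSubspace (ZMod 2) (BVec n × BVec n)}
    {p₀ : BVec n × BVec n} (hp₀ : p₀ ∈ U) :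
    IsAffineOn f U ↔ ∃ (l : BVec n × BVec n →ₗ[ZMod 2] ZMod 2) (c : ZMod 2),
      ∀ d ∈ U.direction, f (p₀ + d) = l d + c := by
  constructor
  · rintro ⟨g, hg⟩
    refine ⟨g.linear, g p₀, fun d hd => ?_⟩
    have hmem : p₀ + d ∈ U := by
      simpa [add_comm] using AffineSubspace.vadd_mem_of_mem_direction hd hp₀
    rw [hg hmem, add_comm p₀ d]
    exact g.map_vadd p₀ d
  · rintro ⟨l, c, h⟩
    refine ⟨l.toAffineMap + AffineMap.const _ _ (c - l p₀), fun p hp => ?_⟩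
    have h1 := h (p - p₀) (AffineSubspace.vsub_mem_direction hp hp₀)
    rw [add_sub_cancel, map_sub] at h1
    rw [h1]
    simp
    ring

theorem IsAffineOn.sub {f g : BoolFun n} {U : AffineSubspace (ZMod 2) (BVec n × BVec n)}
    (hf : IsAffineOn f U) (hg : IsAffineOn g U) : IsAffineOn (f - g) U := by
  obtain ⟨a, ha⟩ := hf
  obtain ⟨b, hb⟩ := hg
  refine ⟨a - b, fun p hp => ?_⟩
  simp [ha hp, hb hp]

theorem IsAffineOn.add {f g : BoolFun n} {U : AffineSubspace (ZMod 2) (BVec n × BVec n)}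
    (hf : IsAffineOn f U) (hg : IsAffineOn g U) : IsAffineOn (f + g) U := by
  obtain ⟨a, ha⟩ := hf
  obtain ⟨b, hb⟩ := hg
  refine ⟨a + b, fun p hp => ?_⟩
  simp [ha hp, hb hp]

/-- The projection of a subspace of `ℤ₂²ⁿ` to the second half of the variables. -/
abbrev sndProj (D : Submodule (ZMod 2) (BVec n × BVec n)) : Submodule (ZMod 2) (BVec n) :=
  D.map (LinearMap.snd (ZMod 2) (BVec n) (BVec n))

/-- The fibre over `0` of the projection to the second half of the variables. -/
abbrev fstFiber (D : Submodule (ZMod 2) (BVec n × BVec n)) : Submodule (ZMod 2) (BVec n) :=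
  D.comap (LinearMap.inl (ZMod 2) (BVec n) (BVec n))

variable {U : AffineSubspace (ZMod 2) (BVec n × BVec n)} {p₀ : BVec n × BVec n}

/-- An affine function has zero second difference in directions `d` and `(e, 0)`. Moving by `(e, 0)`
leaves `y` fixed, so `φ` cancels and only `⟨e, π y - π y₀⟩` remains. -/
theorem IsAffineOn.perm_sub_mem {π : Equiv.Perm (BVec n)} {φ : BVec n → ZMod 2} (hp₀ : p₀ ∈ U)
    (h : IsAffineOn (mmFun π φ) U) (y : BVec n) (hy : y - p₀.2 ∈ sndProj U.direction) :
    π y - π p₀.2 ∈ dotOrthogonal (fstFiber U.direction) := by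
  obtain ⟨l, c, hl⟩ := (isAffineOn_iff hp₀).1 h
  obtain ⟨⟨x, y'⟩, hd, hy'⟩ := hy
  obtain rfl : y = p₀.2 + y' := by
    have hy'' : y' = y - p₀.2 := hy'
    rw [hy'', add_sub_cancel]
  rw [mem_dotOrthogonal]
  intro e he
  have he' : ((e, 0) : BVec n × BVec n) ∈ U.direction := he
  have h1 := hl _ hd
  have h2 := hl _ (U.direction.add_mem hd he')
  have h3 := hl _ he'
  have h4 := hl 0 U.direction.zero_mem
  rw [map_add] at h2
  rw [map_zero] at h4
  simp only [mmFun, Prod.fst_add, Prod.snd_add, add_zero, add_dotProduct] at h1 h2 h3 h4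
  rw [dotProduct_sub]
  linear_combination h2 - h1 - h3 + h4

/-- Choose a section `a` of `U` over its projection. With `φ y = ⟨a y, π y₀ - π y⟩`, the function
equals `⟨x, π y₀⟩` on `U`, because `x - a y` lies in the fibre and is orthogonal to `π y - π y₀`. -/
theorem exists_isAffineOn_mmFun {π : Equiv.Perm (BVec n)} (hp₀ : p₀ ∈ U)
    (h : ∀ y, y - p₀.2 ∈ sndProj U.direction →
      π y - π p₀.2 ∈ dotOrthogonal (fstFiber U.direction)) :
    ∃ φ, IsAffineOn (mmFun π φ) U := by
  have hex : ∀ y, ∃ a : BVec n, y - p₀.2 ∈ sndProj U.direction →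
      (a - p₀.1, y - p₀.2) ∈ U.direction := by
    intro y
    by_cases hy : y - p₀.2 ∈ sndProj U.direction
    · obtain ⟨⟨x, y'⟩, hd, rfl : y' = _⟩ := hy
      exact ⟨x + p₀.1, fun _ => by simpa using hd⟩
    · exact ⟨0, fun hy' => absurd hy' hy⟩
  choose a ha using hex
  refine ⟨fun y => a y ⬝ᵥ (π p₀.2 - π y), (isAffineOn_iff hp₀).2
    ⟨dotProductBilin (ZMod 2) (ZMod 2) (π p₀.2) ∘ₗ LinearMap.fst _ _ _, p₀.1 ⬝ᵥ π p₀.2, ?_⟩⟩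
  rintro ⟨x, y⟩ hd
  have hy : p₀.2 + y - p₀.2 ∈ sndProj U.direction := by
    rw [add_sub_cancel_left]
    exact ⟨(x, y), hd, rfl⟩
  have h1 := ha _ hy
  have h2 : p₀.1 + x - a (p₀.2 + y) ∈ fstFiber U.direction := by
    have := U.direction.sub_mem hd h1
    simp only [add_sub_cancel_left, Prod.mk_sub_mk, sub_self] at this
    rw [Submodule.mem_comap, LinearMap.inl_apply]
    convert this using 2
    abel
  have h3 := mem_dotOrthogonal.1 (h _ hy) _ h2
  have h4 : dotProductBilin (ZMod 2) (ZMod 2) (π p₀.2) x = x ⬝ᵥ π p₀.2 :=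
    dotProduct_comm (π p₀.2) x
  rw [LinearMap.comp_apply, LinearMap.fst_apply, h4]
  simp only [mmFun, Prod.fst_add, Prod.snd_add]
  simp only [dotProduct_sub, sub_dotProduct, add_dotProduct] at h3 ⊢
  linear_combination h3

theorem isAffineOn_comp_snd_iff {φ : BVec n → ZMod 2} (hp₀ : p₀ ∈ U) :
    IsAffineOn (fun p => φ p.2) U ↔
      ∃ (l : sndProj U.direction →ₗ[ZMod 2] ZMod 2) (c : ZMod 2),
        ∀ w : sndProj U.direction, φ (p₀.2 + w) = l w + c := by
  rw [isAffineOn_iff hp₀]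
  constructor
  · rintro ⟨l, c, hl⟩
    have key : ∀ (x : BVec n) (w : BVec n), (x, w) ∈ U.direction →
        φ (p₀.2 + w) - c = l (x, w) := fun x w hw => sub_eq_of_eq_add (hl _ hw)
    have hex : ∀ w : sndProj U.direction, ∃ x : BVec n, (x, (w : BVec n)) ∈ U.direction := by
      rintro ⟨_, p, hp, rfl⟩
      exact ⟨p.1, hp⟩
    choose a ha using hex
    refine ⟨{ toFun := fun w => φ (p₀.2 + w) - c
              map_add' := fun v w => ?_
              map_smul' := fun t w => ?_ }, c, fun w => by simp⟩
    · rw [key _ _ (ha v), key _ _ (ha w), ← map_add]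
      exact key _ _ (U.direction.add_mem (ha v) (ha w))
    · rw [key _ _ (ha w), ← map_smul]
      exact key _ _ (U.direction.smul_mem t (ha w))
  · rintro ⟨l, c, hl⟩
    obtain ⟨l', hl'⟩ := LinearMap.exists_extend l
    refine ⟨l' ∘ₗ LinearMap.snd _ _ _, c, fun d hd => ?_⟩
    have hw : d.2 ∈ sndProj U.direction := ⟨d, hd, rfl⟩
    have h1 : l' d.2 = l ⟨d.2, hw⟩ := LinearMap.congr_fun hl' ⟨d.2, hw⟩
    rw [LinearMap.comp_apply, LinearMap.snd_apply, h1]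
    exact hl ⟨d.2, hw⟩

theorem natCard_submodule_bVec {W : Submodule (ZMod 2) (BVec n)} {k : ℕ}
    (hW : Module.finrank (ZMod 2) W = k) : Nat.card W = 2 ^ k := by
  rw [Module.natCard_eq_pow_finrank (K := ZMod 2), hW, Nat.card_zmod]

theorem natCard_bVec : Nat.card (BVec n) = 2 ^ n := by
  simp

/-- Subtracting one good `ψ` cancels the bilinear term, leaving a function of `y` alone; it is
affine on `U` exactly when it is affine on the projected coset. -/
theorem natCard_isAffineOn_mmFun_of_perm {π : Equiv.Perm (BVec n)} {k : ℕ} (hp₀ : p₀ ∈ U)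
    (hk : Module.finrank (ZMod 2) (sndProj U.direction) = k)
    (h : ∀ y, y - p₀.2 ∈ sndProj U.direction →
      π y - π p₀.2 ∈ dotOrthogonal (fstFiber U.direction)) :
    Nat.card {φ // IsAffineOn (mmFun π φ) U} = 2 ^ k * 2 * 2 ^ (2 ^ n - 2 ^ k) := by
  obtain ⟨ψ, hψ⟩ := exists_isAffineOn_mmFun hp₀ h
  have hcount := natCard_affine_on_coset (sndProj U.direction) p₀.2
  rw [natCard_submodule_bVec hk, natCard_bVec, Nat.card_zmod] at hcount
  rw [← hcount]
  refine Nat.card_congr ((Equiv.subRight ψ).subtypeEquiv fun φ => ?_)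
  rw [← isAffineOn_comp_snd_iff hp₀]
  have heq : (fun p : BVec n × BVec n => (Equiv.subRight ψ φ) p.2) = mmFun π φ - mmFun π ψ := by
    ext p
    simp [mmFun]
  rw [heq]
  exact ⟨fun h => h.sub hψ, fun h => by simpa using h.add hψ⟩

theorem natCard_isAffineOn_mmFun {k : ℕ} (hU : IsAffineSubspaceOfDim n U)
    (hk : Module.finrank (ZMod 2) (sndProj U.direction) = k) :
    Nat.card {t : Equiv.Perm (BVec n) × (BVec n → ZMod 2) // IsAffineOn (mmFun t.1 t.2) U} =
      2 ^ (n - k) * ((2 ^ k).factorial * (2 ^ n - 2 ^ k).factorial) *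
        (2 ^ k * 2 * 2 ^ (2 ^ n - 2 ^ k)) := by
  obtain ⟨⟨p₀, hp₀ : p₀ ∈ U⟩, hn⟩ := hU
  have hF : Module.finrank (ZMod 2) (dotOrthogonal (fstFiber U.direction)) = k := by
    have h1 : Module.finrank (ZMod 2) (sndProj U.direction) +
        Module.finrank (ZMod 2) (fstFiber U.direction) = Module.finrank (ZMod 2) U.direction :=
      finrank_map_snd_add_finrank_comap_inl U.direction
    rw [finrank_dotOrthogonal]
    omega
  have hperm := natCard_perm_coset (sndProj U.direction)
    (dotOrthogonal (fstFiber U.direction)) p₀.2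
    ((natCard_submodule_bVec hk).trans (natCard_submodule_bVec hF).symm)
  have hquot : Nat.card (BVec n ⧸ dotOrthogonal (fstFiber U.direction)) = 2 ^ (n - k) := by
    have h1 := Submodule.finrank_quotient_add_finrank (dotOrthogonal (fstFiber U.direction))
    rw [Module.finrank_fin_fun] at h1
    rw [Module.natCard_eq_pow_finrank (K := ZMod 2), Nat.card_zmod]
    congr 1
    omega
  rw [hquot, natCard_submodule_bVec hk, natCard_bVec] at hperm
  rw [← hperm]
  refine natCard_eq_mul_of_natCard_fiber (fun t => ⟨t.1.1, t.2.perm_sub_mem hp₀⟩) _ ?_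
  rintro ⟨π, hπ⟩
  rw [← natCard_isAffineOn_mmFun_of_perm hp₀ hk hπ]
  refine Nat.card_congr ⟨fun t => ⟨t.1.1.2, ?_⟩, fun φ => ⟨⟨(π, φ.1), φ.2⟩, rfl⟩, ?_, ?_⟩
  · have h1 : t.1.1.1 = π := congrArg Subtype.val t.2
    have h2 := t.1.2
    rwa [h1] at h2
  · rintro ⟨⟨⟨π', φ⟩, h1⟩, h2⟩
    obtain rfl : π' = π := congrArg Subtype.val h2
    rfl
  · intro φ
    rfl

instance : Finite (AffineSubspace (ZMod 2) (BVec n × BVec n)) :=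
  Finite.of_injective _ SetLike.coe_injective

/-- The number of `n`-dimensional affine subspaces whose projection has dimension `k`. -/
theorem natCard_affineSubspace_sndProj {k : ℕ} (hk : k ≤ n) :
    (Nat.card {U : AffineSubspace (ZMod 2) (BVec n × BVec n) // IsAffineSubspaceOfDim n U ∧
        Module.finrank (ZMod 2) (sndProj U.direction) = k} : ℚ) =
      gaussBinom n k ^ 2 * 2 ^ (k * k) * 2 ^ n := by
  have h1 : Nat.card {U : AffineSubspace (ZMod 2) (BVec n × BVec n) //
      IsAffineSubspaceOfDim n U ∧ Module.finrank (ZMod 2) (sndProj U.direction) = k} =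
      Nat.card {D : Submodule (ZMod 2) (BVec n × BVec n) //
        Module.finrank (ZMod 2) D = k + (n - k) ∧
          Module.finrank (ZMod 2) (sndProj D) = k} * 2 ^ n := by
    refine natCard_eq_mul_of_natCard_fiber (fun U => ⟨U.1.direction, by
      rw [Nat.add_sub_cancel' hk]
      exact ⟨U.2.1.2, U.2.2⟩⟩) _ ?_
    rintro ⟨D, hD, hD'⟩
    have hquot : Nat.card ((BVec n × BVec n) ⧸ D) = 2 ^ n := by
      have h1 := Submodule.finrank_quotient_add_finrank D
      rw [Module.finrank_prod, Module.finrank_fin_fun] at h1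
      rw [Module.natCard_eq_pow_finrank (K := ZMod 2), Nat.card_zmod]
      congr 1
      omega
    rw [← hquot, ← natCard_affineSubspace_of_direction_eq]
    simp only [Subtype.mk.injEq]
    refine Nat.card_congr ((Equiv.subtypeSubtypeEquivSubtypeInter _
      fun U : AffineSubspace (ZMod 2) (BVec n × BVec n) => U.direction = D).trans
        (Equiv.subtypeEquivRight fun U => ?_))
    constructor
    · rintro ⟨⟨⟨h1, -⟩, -⟩, h2⟩
      exact ⟨h1, h2⟩
    · rintro ⟨h1, rfl⟩
      exact ⟨⟨⟨h1, hD.trans (Nat.add_sub_cancel' hk)⟩, hD'⟩, rfl⟩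
  rw [h1, natCard_submodule_prod_finrank (Nat.sub_le n k) (Module.finrank_fin_fun _),
    natCard_submodule_compl_finrank hk, Nat.card_zmod, Nat.sub_sub_self hk]
  push_cast
  rw [gaussBinom_eq (Module.finrank_fin_fun _) hk]
  ring

end AffineOn

/-! ### Double counting and evaluation of the summands. -/

section Average

variable {n : ℕ}

/-- Setting `x = 0` recovers `φ`; nondegeneracy of the dot product then recovers `π`. -/
theorem mmFun_injective : Function.Injective
    (fun t : Equiv.Perm (BVec n) × (BVec n → ZMod 2) => mmFun t.1 t.2) := by
  rintro ⟨π, φ⟩ ⟨π', φ'⟩ h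
  have h' : ∀ x y, x ⬝ᵥ π y + φ y = x ⬝ᵥ π' y + φ' y := fun x y => congrFun h (x, y)
  have hφ : φ = φ' := funext fun y => by simpa using h' 0 y
  subst hφ
  have hπ : π = π' := Equiv.ext fun y => dotProduct_eq _ _ fun x => by
    rw [dotProduct_comm, dotProduct_comm (π' y)]
    exact add_right_cancel (h' x y)
  rw [hπ]

theorem charFun_injective : Function.Injective (charFun (n := n)) :=
  fun _ _ h => Set.indicator_one_inj (M₀ := ZMod 2) h

theorem ncard_near (f : BoolFun n) : (near f).ncard =
    Nat.card {U : AffineSubspace (ZMod 2) (BVec n × BVec n) //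
      IsAffineSubspaceOfDim n U ∧ IsAffineOn f U} := by
  rw [← Nat.card_coe_set_eq]
  symm
  refine Nat.card_eq_of_bijective (fun U => ⟨f + charFun (U.1 : Set (BVec n × BVec n)),
    U.1, U.2.1, U.2.2, rfl⟩) ⟨?_, ?_⟩
  · intro U U' h
    exact Subtype.ext (SetLike.coe_injective
      (charFun_injective (add_left_cancel (congrArg Subtype.val h))))
  · rintro ⟨_, U, h1, h2, rfl⟩
    exact ⟨⟨U, h1, h2⟩, rfl⟩

theorem mmClass_eq_range : MMClass n =
    Set.range (fun t : Equiv.Perm (BVec n) × (BVec n → ZMod 2) => mmFun t.1 t.2) := by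
  ext f
  simp [MMClass, eq_comm]

theorem ncard_mmClass : (MMClass n).ncard = (2 ^ n).factorial * 2 ^ 2 ^ n := by
  rw [mmClass_eq_range, ← Nat.card_coe_set_eq, Nat.card_range_of_injective mmFun_injective,
    Nat.card_prod, Nat.card_perm, Nat.card_fun (α := BVec n), natCard_bVec, Nat.card_zmod]

theorem sum_ncard_near :
    ∑ f ∈ (MMClass n).toFinite.toFinset, ((near f).ncard : ℚ) =
      ∑ t : Equiv.Perm (BVec n) × (BVec n → ZMod 2), ((near (mmFun t.1 t.2)).ncard : ℚ) := by
  symm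
  refine Finset.sum_nbij (fun t => mmFun t.1 t.2) ?_ mmFun_injective.injOn ?_ fun _ _ => rfl
  · rintro ⟨π, φ⟩ -
    exact (Set.Finite.mem_toFinset _).2 ⟨π, φ, rfl⟩
  · intro f hf
    rw [Set.Finite.coe_toFinset] at hf
    obtain ⟨π, φ, rfl⟩ := hf
    exact ⟨(π, φ), by simp, rfl⟩

theorem sum_natCard_comm {α β : Type*} [Fintype α] [Fintype β] (r : α → β → Prop) :
    ∑ a, Nat.card {b // r a b} = ∑ b, Nat.card {a // r a b} := by
  rw [← Nat.card_sigma, ← Nat.card_sigma]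
  exact Nat.card_congr
    ⟨fun x => ⟨x.2.1, x.1, x.2.2⟩, fun x => ⟨x.2.1, x.1, x.2.2⟩, fun _ => rfl, fun _ => rfl⟩

theorem sum_ncard_near_eq :
    ∑ f ∈ (MMClass n).toFinite.toFinset, ((near f).ncard : ℚ) =
      ∑ k ∈ Finset.range (n + 1), gaussBinom n k ^ 2 * 2 ^ (k * k) * 2 ^ n *
        (2 ^ (n - k) * ((2 ^ k).factorial * (2 ^ n - 2 ^ k).factorial) *
          (2 ^ k * 2 * 2 ^ (2 ^ n - 2 ^ k))) := by
  classical
  have := Fintype.ofFinite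
    {U : AffineSubspace (ZMod 2) (BVec n × BVec n) // IsAffineSubspaceOfDim n U}
  have hswap : ∑ t : Equiv.Perm (BVec n) × (BVec n → ZMod 2), (near (mmFun t.1 t.2)).ncard =
      ∑ U : {U : AffineSubspace (ZMod 2) (BVec n × BVec n) // IsAffineSubspaceOfDim n U},
        Nat.card {t : Equiv.Perm (BVec n) × (BVec n → ZMod 2) //
          IsAffineOn (mmFun t.1 t.2) U.1} := by
    rw [← sum_natCard_comm]
    refine Finset.sum_congr rfl fun t _ => ?_
    rw [ncard_near]
    exact Nat.card_congr (Equiv.subtypeSubtypeEquivSubtypeInter _ _).symm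
  have hmaps : ∀ U ∈ (Finset.univ : Finset {U : AffineSubspace (ZMod 2) (BVec n × BVec n) //
      IsAffineSubspaceOfDim n U}),
      Module.finrank (ZMod 2) (sndProj U.1.direction) ∈ Finset.range (n + 1) := by
    intro U _
    have h := Submodule.finrank_le (sndProj U.1.direction)
    rw [Module.finrank_fin_fun] at h
    exact Finset.mem_range.2 (Nat.lt_succ_of_le h)
  rw [sum_ncard_near, ← Nat.cast_sum, hswap, ← Finset.sum_fiberwise_of_maps_to hmaps,
    Nat.cast_sum]
  refine Finset.sum_congr rfl fun k hk => ?_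
  have hk' : k ≤ n := Nat.lt_succ_iff.1 (Finset.mem_range.1 hk)
  rw [← natCard_affineSubspace_sndProj hk', Finset.sum_congr rfl fun U hU =>
    natCard_isAffineOn_mmFun U.2 (Finset.mem_filter.1 hU).2, Finset.sum_const, smul_eq_mul,
    Nat.cast_mul]
  congr 1
  · rw [← Fintype.card_subtype, ← Nat.card_eq_fintype_card]
    exact congrArg Nat.cast (Nat.card_congr (Equiv.subtypeSubtypeEquivSubtypeInter _
      fun U : AffineSubspace (ZMod 2) (BVec n × BVec n) =>
        Module.finrank (ZMod 2) (sndProj U.direction) = k))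
  · push_cast
    rfl

/-- The exponents match because `k² + n + (n - k) + (k + 1) = 2(n - k) + (k + 1)²`. -/
theorem rho_mul_eq {k : ℕ} (hk : k ≤ n) :
    gaussBinom n k ^ 2 * 2 ^ (k * k) * 2 ^ n *
        (2 ^ (n - k) * ((2 ^ k).factorial * (2 ^ n - 2 ^ k).factorial) *
          (2 ^ k * 2 * 2 ^ (2 ^ n - 2 ^ k))) / (((2 ^ n).factorial * 2 ^ 2 ^ n : ℕ) : ℚ) =
      rho n k * (2 : ℚ) ^ (((k : ℤ) + 1) ^ 2 - 2 ^ k) := by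
  have hpow : (2 : ℚ) ^ (((k : ℤ) + 1) ^ 2 - 2 ^ k) = 2 ^ ((k + 1) ^ 2) / 2 ^ 2 ^ k := by
    rw [zpow_sub₀ two_ne_zero, ← zpow_natCast, ← zpow_natCast]
    push_cast
    rfl
  have hle : 2 ^ k ≤ 2 ^ n := Nat.pow_le_pow_right two_pos hk
  have hfac : ((2 ^ n).factorial : ℚ) ≠ 0 := Nat.cast_ne_zero.2 (Nat.factorial_ne_zero _)
  -- Replacing `2^n - 2^k` by `m` and `n - k` by `j` removes truncated subtraction before `ring`.
  obtain ⟨m, hm⟩ := Nat.exists_eq_add_of_le hle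
  obtain ⟨j, rfl⟩ := Nat.exists_eq_add_of_le hk
  rw [hpow, rho]
  simp only [hm, Nat.add_sub_cancel_left] at hfac ⊢
  push_cast
  field_simp
  ring

theorem rho_zero_mul : rho n 0 * (2 : ℚ) ^ ((((0 : ℕ) : ℤ) + 1) ^ 2 - 2 ^ 0) = 2 ^ n := by
  have hfac : ((2 ^ n).factorial : ℚ) = 2 ^ n * ((2 ^ n - 1).factorial : ℚ) := by
    rw [← Nat.mul_factorial_pred (pow_pos two_pos n).ne']
    push_cast
    rfl
  have h : ((2 ^ n - 1).factorial : ℚ) ≠ 0 := Nat.cast_ne_zero.2 (Nat.factorial_ne_zero _)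
  simp only [rho, gaussBinom, hfac, Finset.range_zero, Finset.prod_empty, pow_zero]
  norm_num
  field_simp
  ring

theorem rho_one_mul (hn : 1 ≤ n) :
    rho n 1 * (2 : ℚ) ^ ((((1 : ℕ) : ℤ) + 1) ^ 2 - 2 ^ 1) = 2 ^ (2 * n + 1) - 2 ^ (n + 1) := by
  have hle : 2 ≤ 2 ^ n := Nat.le_self_pow (by omega) 2
  have hfac : ((2 ^ n).factorial : ℚ) = 2 ^ n * (2 ^ n - 1) * ((2 ^ n - 2).factorial : ℚ) := by
    rw [← Nat.mul_factorial_pred (by omega : 2 ^ n ≠ 0),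
      ← Nat.mul_factorial_pred (by omega : 2 ^ n - 1 ≠ 0), Nat.sub_sub, Nat.cast_mul,
      Nat.cast_mul, Nat.cast_sub (by omega)]
    push_cast
    ring
  have h : ((2 ^ n - 2).factorial : ℚ) ≠ 0 := Nat.cast_ne_zero.2 (Nat.factorial_ne_zero _)
  have h1 : (2 : ℚ) ^ n - 1 ≠ 0 := by
    have : (2 : ℚ) ≤ 2 ^ n := by exact_mod_cast hle
    linarith
  have hg : gaussBinom n 1 = 2 ^ n - 1 := by
    norm_num [gaussBinom]
  rw [rho, hg, hfac, pow_one, Nat.factorial_two]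
  obtain ⟨m, rfl⟩ := Nat.exists_eq_add_of_le hn
  rw [Nat.add_sub_cancel_left]
  norm_num
  field_simp
  ring

end Average

theorem mainTheorem1 (n : ℕ) :
    nearAverage n = (2 : ℚ) ^ (2 * n + 1) - 2 ^ n +
      ∑ k ∈ Finset.Icc 2 n, rho n k * (2 : ℚ) ^ (((k : ℤ) + 1) ^ 2 - 2 ^ k) := by
  have hsum : nearAverage n =
      ∑ k ∈ Finset.range (n + 1), rho n k * (2 : ℚ) ^ (((k : ℤ) + 1) ^ 2 - 2 ^ k) := by
    rw [nearAverage, sum_ncard_near_eq, ncard_mmClass, Finset.sum_div]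
    exact Finset.sum_congr rfl fun k hk => rho_mul_eq (Nat.lt_succ_iff.1 (Finset.mem_range.1 hk))
  rw [hsum]
  -- For `n = 0` there is no `k = 1` term; the `k = 0` term is `1 = 2^1 - 2^0`.
  rcases Nat.eq_zero_or_pos n with rfl | hn
  · rw [Finset.sum_range_one, rho_zero_mul, Finset.Icc_eq_empty (by norm_num)]
    norm_num
  · rw [Finset.range_eq_Ico, Finset.sum_eq_sum_Ico_succ_bot (by omega),
      Finset.sum_eq_sum_Ico_succ_bot (by omega), rho_zero_mul, rho_one_mul hn]
    have hIco : Finset.Ico (0 + 1 + 1) (n + 1) = Finset.Icc 2 n := by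
      ext k
      simp only [Finset.mem_Ico, Finset.mem_Icc]
      omega
    rw [hIco]
    ring
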